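/- For each $n$ let every triple $T\in\binom{[n]}{3}$ have a birth time, these birth times being independent and uniformly distributed on $[0,1]$, and for $p\in[0,1]$ let $\mathcal H_p$ be the random simplicial complex on vertex set $[n]$ generated by (i.e. the downward-closure of) the set of triples with birth time at most $p$. The 2-simplices of a complex are called faces, its 1-simplices edges, and its shadow graph is the graph formed by its vertices and edges. A copy of $M$ in a complex is a face with vertices $a,b,c$ such that the edges $ab$ and $ac$ lie in no other face, and such that there is a path in the shadow graph between $a$ and $b$ using neither of the edges $ab$ and $ac$. Let $p_M$ be the birth time of the face whose birth destroys the last copy of $M$: immediately before time $p_M$ the complex contains a copy of $M$, and $\mathcal H_p$ contains no copy of $M$ for every $p\ge p_M$. Then with high probability $$p_M=\frac{\log n+\frac12\log\log n+O(1)}{n},$$ in the following sense: for every function $\omega=\omega(n)$ with $\omega(n)\to\infty$ as $n\to\infty$, with probability tending to $1$ as $n\to\infty$, $p_M$ exists and $$\left|\,n\,p_M-\left(\log n+\tfrac12\log\log n\right)\right|\le\omega(n).$$ -/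

import Mathlib

open MeasureTheory Filter Topology

namespace HypergraphComplex

/-- The simplicial complex generated by a hypergraph with edge set `E`: the downward-closure of `E`,
i.e. all non-empty finite sets contained in some hyperedge. -/
def generated {V : Type*} (E : Set (Finset V)) : PreAbstractSimplicialComplex V where
  faces := {A | A.Nonempty ∧ ∃ B ∈ E, A ⊆ B}
  isRelLowerSet_faces := by
    rintro A ⟨hA, B, hB, hAB⟩
    exact ⟨hA, fun C hCA hC => ⟨hC, B, hB, hCA.trans hAB⟩⟩

/-- `T` is a face (a 2-simplex) of the complex `X`. -/
def IsFace {V : Type*} (X : PreAbstractSimplicialComplex V) (T : Finset V) : Prop :=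
  T ∈ X ∧ T.card = 3

/-- The shadow graph of `X`, whose edges are the 1-simplices of `X`. -/
def shadow {V : Type*} [DecidableEq V] (X : PreAbstractSimplicialComplex V) : SimpleGraph V where
  Adj x y := x ≠ y ∧ ({x, y} : Finset V) ∈ X
  symm := ⟨fun x y h => ⟨h.1.symm, by rw [Finset.pair_comm]; exact h.2⟩⟩
  loopless := ⟨fun _ h => h.1 rfl⟩

/-- The vertices `a, b, c` form a copy of the minimal obstruction `M` in `X`: `abc` is a face, the
edges `ab` and `ac` lie in no other face, and the shadow graph contains a path from `a` to `b` that
uses neither of the edges `ab` and `ac`. -/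
def IsCopyM {V : Type*} [DecidableEq V] (X : PreAbstractSimplicialComplex V) (a b c : V) : Prop :=
  IsFace X {a, b, c} ∧
  (∀ F : Finset V, IsFace X F → ({a, b} : Finset V) ⊆ F → F = {a, b, c}) ∧
  (∀ F : Finset V, IsFace X F → ({a, c} : Finset V) ⊆ F → F = {a, b, c}) ∧
  ∃ P : (shadow X).Walk a b, P.IsPath ∧ s(a, b) ∉ P.edges ∧ s(a, c) ∉ P.edges

/-- `M ⊂ X`: the complex `X` contains a copy of `M`. -/
def ContainsM {V : Type*} [DecidableEq V] (X : PreAbstractSimplicialComplex V) : Prop :=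
  ∃ a b c : V, IsCopyM X a b c

/-- The triples of vertices of an `n`-element vertex set. -/
abbrev Triple (n : ℕ) : Type := {T : Finset (Fin n) // T.card = 3}

/-- The law of the birth times: independent and uniform on `[0, 1]`, one for each triple. -/
noncomputable def birthLaw (n : ℕ) : Measure (Triple n → ℝ) :=
  Measure.pi fun _ => (volume : Measure ℝ).restrict (Set.Icc 0 1)

instance (n : ℕ) : IsProbabilityMeasure (birthLaw n) := by
  have : IsProbabilityMeasure ((volume : Measure ℝ).restrict (Set.Icc 0 1)) := ⟨by simp⟩
  unfold birthLaw
  infer_instance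

/-- The complex `H_p`, generated by the triples whose birth time is at most `p`. -/
def complexAt {n : ℕ} (β : Triple n → ℝ) (p : ℝ) : PreAbstractSimplicialComplex (Fin n) :=
  generated {A | ∃ T : Triple n, T.1 = A ∧ β T ≤ p}

/-- The complex just before time `p`, generated by the triples born strictly before time `p`. -/
def complexBefore {n : ℕ} (β : Triple n → ℝ) (p : ℝ) : PreAbstractSimplicialComplex (Fin n) :=
  generated {A | ∃ T : Triple n, T.1 = A ∧ β T < p}

/-- The birth of the face `T` destroys the last copy of `M`: just before that moment the complex
contains a copy of `M`, and from that moment on it never does. -/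
def DestroysLastM {n : ℕ} (β : Triple n → ℝ) (T : Triple n) : Prop :=
  ContainsM (complexBefore β (β T)) ∧ ∀ p : ℝ, β T ≤ p → ¬ ContainsM (complexAt β p)

/-- The birth time of a face destroying the last copy of `M` is unique. -/
theorem DestroysLastM.birth_eq {n : ℕ} {β : Triple n → ℝ} {T T' : Triple n}
    (h : DestroysLastM β T) (h' : DestroysLastM β T') : β T = β T' := by
  have key : ∀ S S' : Triple n, DestroysLastM β S → DestroysLastM β S' → ¬ β S < β S' := by
    intro S S' hS hS' hlt
    obtain ⟨R, hR, hmax⟩ := Finset.exists_max_image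
      (Finset.univ.filter fun R : Triple n => β R < β S') β ⟨S, by simpa using hlt⟩
    simp only [Finset.mem_filter, Finset.mem_univ, true_and] at hR hmax
    have heq : complexBefore β (β S') = complexAt β (β R) := by
      unfold complexBefore complexAt
      congr 1
      ext A
      exact ⟨fun ⟨Q, hQ, hlt⟩ => ⟨Q, hQ, hmax Q hlt⟩, fun ⟨Q, hQ, hle⟩ => ⟨Q, hQ, hle.trans_lt hR⟩⟩
    exact hS.2 (β R) (hmax S hlt) (heq ▸ hS'.1)
  exact le_antisymm (not_lt.1 (key _ _ h' h)) (not_lt.1 (key _ _ h h'))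

end HypergraphComplex

/-! For fixed `a, b, c`, the two free edges require that none of the `2 * (n - 3)` other triples
through `ab` or `ac` (the rivals) is born yet. So the expected number of copies at time `p` is of
order `n ^ 3 * p * exp (-2 * n * p)`. At `n * p = log n + (1/2) log log n + w` the factor `p`
contributes about `log n / n`, which the `(1/2) log log n` cancels, leaving order `exp (-2 * w)`.

Upper bound: containing `M` is not monotone in time, so a first moment bound at one time is not
enough. `birthLaw_late_rivals_le` bounds the chance that a triple is isolated at any time from `p`
on, at the cost of a constant factor.

Lower bound: Chebyshev's inequality is applied to the events that a triple is born and its rivals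
are not. Two such events are either incompatible or have at most four rivals in common
(`card_rivals_inter_rivals_le`), hence are almost uncorrelated. The path then comes almost for free,
as `a`-`x`-`b` through a fourth vertex `x`.

If `M` is present at one time and absent from a later time on, `exists_destroysLastM` supplies the
destroying birth in between. -/

namespace HypergraphComplex

/-! ### Counting rival triples. -/

/-- The triples that contain `a` and `b` and avoid `F`. -/
def link {n : ℕ} (a b : Fin n) (F : Finset (Fin n)) : Finset (Triple n) :=
  Finset.univ.filter fun S => a ∈ S.1 ∧ b ∈ S.1 ∧ Disjoint S.1 F

theorem mem_link {n : ℕ} {a b : Fin n} {F : Finset (Fin n)} {S : Triple n} :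
    S ∈ link a b F ↔ a ∈ S.1 ∧ b ∈ S.1 ∧ Disjoint S.1 F := by
  simp [link]

theorem card_link {n : ℕ} {a b : Fin n} {F : Finset (Fin n)} (hab : a ≠ b) (ha : a ∉ F)
    (hb : b ∉ F) : (link a b F).card = n - 2 - F.card := by
  have hcard : (Finset.univ \ ({a, b} ∪ F)).card = n - 2 - F.card := by
    rw [Finset.card_sdiff_of_subset (Finset.subset_univ _), Finset.card_union_of_disjoint,
      Finset.card_pair hab, Finset.card_univ, Fintype.card_fin]
    · omega
    · simp [ha, hb]
  rw [← hcard]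
  have hz : ∀ z ∈ Finset.univ \ ({a, b} ∪ F), z ≠ a ∧ z ≠ b ∧ z ∉ F := by
    intro z hz
    simpa [not_or, and_assoc] using hz
  symm
  refine Finset.card_bij (fun z hz' => ⟨{a, b, z}, Finset.card_eq_three.2
    ⟨a, b, z, hab, (hz z hz').1.symm, (hz z hz').2.1.symm, rfl⟩⟩) ?_ ?_ ?_
  · intro z hz'
    obtain ⟨h1, h2, h3⟩ := hz z hz'
    simp [mem_link, ha, hb, h3]
  · intro z hz' y hy' h
    obtain ⟨h1, h2, h3⟩ := hz z hz'
    have h4 : z ∈ ({a, b, y} : Finset (Fin n)) := by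
      have h5 : ({a, b, z} : Finset (Fin n)) = {a, b, y} := congrArg Subtype.val h
      rw [← h5]
      simp
    simpa [h1, h2] using h4
  · intro S hS
    obtain ⟨hSa, hSb, hSF⟩ := mem_link.1 hS
    have hsub : ({a, b} : Finset (Fin n)) ⊆ S.1 := by
      simp [Finset.insert_subset_iff, hSa, hSb]
    have h1 : (S.1 \ {a, b}).card = 1 := by
      rw [Finset.card_sdiff_of_subset hsub, Finset.card_pair hab, S.2]
    obtain ⟨z, hz1⟩ := Finset.card_eq_one.1 h1
    have hzS : z ∈ S.1 \ {a, b} := by simp [hz1]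
    have hzS' : z ∈ S.1 ∧ z ≠ a ∧ z ≠ b := by simpa using hzS
    refine ⟨z, ?_, ?_⟩
    · simp [hzS'.2.1, hzS'.2.2, Finset.disjoint_left.1 hSF hzS'.1]
    · apply Subtype.ext
      refine Finset.eq_of_subset_of_card_le ?_ ?_
      · simp [Finset.insert_subset_iff, hSa, hSb, hzS'.1]
      · rw [S.2, Finset.card_eq_three.2 ⟨a, b, z, hab, hzS'.2.1.symm, hzS'.2.2.symm, rfl⟩]

/-- The triples other than `abc` that contain one of the edges `ab` and `ac`. -/
def rivals {n : ℕ} (a b c : Fin n) : Finset (Triple n) :=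
  link a b {c} ∪ link a c {b}

theorem card_rivals {n : ℕ} {a b c : Fin n} (hab : a ≠ b) (hac : a ≠ c) (hbc : b ≠ c) :
    (rivals a b c).card = 2 * (n - 3) := by
  unfold rivals
  rw [Finset.card_union_of_disjoint, card_link hab (by simpa) (by simpa),
    card_link hac (by simpa) (by simpa using hbc.symm)]
  · simp only [Finset.card_singleton]
    omega
  · rw [Finset.disjoint_left]
    intro S h1 h2
    rw [mem_link] at h1 h2
    exact Finset.disjoint_singleton_right.1 h2.2.2 h1.2.1

theorem eq_of_card_eq_three {V : Type*} [DecidableEq V] {S : Finset V} (hS : S.card = 3)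
    {a b c : V} (hab : a ≠ b) (hac : a ≠ c) (hbc : b ≠ c) (ha : a ∈ S) (hb : b ∈ S) (hc : c ∈ S) :
    S = {a, b, c} := by
  symm
  refine Finset.eq_of_subset_of_card_le ?_ ?_
  · simp [Finset.insert_subset_iff, ha, hb, hc]
  · rw [hS, Finset.card_eq_three.2 ⟨a, b, c, hab, hac, hbc, rfl⟩]

theorem mem_rivals_of_subset {n : ℕ} {a b c : Fin n} (hab : a ≠ b) (hac : a ≠ c) (hbc : b ≠ c)
    {S : Triple n} (hS : S.1 ≠ {a, b, c})
    (h : ({a, b} : Finset (Fin n)) ⊆ S.1 ∨ ({a, c} : Finset (Fin n)) ⊆ S.1) :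
    S ∈ rivals a b c := by
  simp only [Finset.insert_subset_iff, Finset.singleton_subset_iff] at h
  simp only [rivals, Finset.mem_union, mem_link, Finset.disjoint_singleton_right]
  have key := fun ha hb hc => hS (eq_of_card_eq_three S.2 hab hac hbc ha hb hc)
  tauto

theorem subset_of_mem_rivals {n : ℕ} {a b c : Fin n} {S : Triple n} (h : S ∈ rivals a b c) :
    S.1 ≠ {a, b, c} ∧
      (({a, b} : Finset (Fin n)) ⊆ S.1 ∨ ({a, c} : Finset (Fin n)) ⊆ S.1) := by
  simp only [rivals, Finset.mem_union, mem_link, Finset.disjoint_singleton_right] at h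
  constructor
  · intro hS
    simp [hS] at h
  · simp only [Finset.insert_subset_iff, Finset.singleton_subset_iff]
    tauto

/-- The hypothesis `h` rules out `{u, v} = {u', v'}`: otherwise `T ≠ T'` would give `w' ∉ T`,
placing `T` in the second link. Two different edges span at least three vertices, so a triple
containing both is their union. -/
theorem card_link_inter_link_le_one {n : ℕ} {u v w u' v' w' : Fin n} {T T' : Triple n}
    (hT : T.1 = {u, v, w}) (hT' : T'.1 = {u', v', w'}) (huv : u ≠ v) (hne : T ≠ T')
    (h : T ∉ link u' v' {w'}) : (link u v {w} ∩ link u' v' {w'}).card ≤ 1 := by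
  have hE : 3 ≤ ({u, v, u', v'} : Finset (Fin n)).card := by
    by_contra hlt
    have heq : ({u, v} : Finset (Fin n)) = {u, v, u', v'} := by
      refine Finset.eq_of_subset_of_card_le ?_ ?_
      · intro z
        simp only [Finset.mem_insert, Finset.mem_singleton]
        tauto
      · rw [Finset.card_pair huv]
        omega
    have hsub : ({u, v} : Finset (Fin n)) ⊆ T.1 := by
      rw [hT]
      intro z
      simp only [Finset.mem_insert, Finset.mem_singleton]
      tauto
    have hu' : u' ∈ T.1 := hsub (heq ▸ by simp)
    have hv' : v' ∈ T.1 := hsub (heq ▸ by simp)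
    apply h
    rw [mem_link, Finset.disjoint_singleton_right]
    refine ⟨hu', hv', fun hw' => hne (Subtype.ext ?_)⟩
    symm
    refine Finset.eq_of_subset_of_card_le ?_ (by rw [T.2, T'.2])
    rw [hT']
    simp [Finset.insert_subset_iff, hu', hv', hw']
  rw [Finset.card_le_one]
  have key : ∀ S ∈ link u v {w} ∩ link u' v' {w'}, S.1 = {u, v, u', v'} := by
    intro S hS
    rw [Finset.mem_inter, mem_link, mem_link] at hS
    symm
    refine Finset.eq_of_subset_of_card_le ?_ (by rwa [S.2])
    simp [Finset.insert_subset_iff, hS.1.1, hS.1.2.1, hS.2.1, hS.2.2.1]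
  intro S hS S' hS'
  exact Subtype.ext ((key S hS).trans (key S' hS').symm)

/-- Each free edge of one triple meets each free edge of the other in at most one common rival, and
there are four such pairs. -/
theorem card_rivals_inter_rivals_le {n : ℕ} {a b c a' b' c' : Fin n} {T T' : Triple n}
    (hT : T.1 = {a, b, c}) (hT' : T'.1 = {a', b', c'}) (hab : a ≠ b) (hac : a ≠ c)
    (hne : T ≠ T') (h : T ∉ rivals a' b' c') : (rivals a b c ∩ rivals a' b' c').card ≤ 4 := by
  simp only [rivals, Finset.mem_union, not_or] at h
  have hTs : T.1 = {a, c, b} := by rw [hT, Finset.pair_comm]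
  have hTs' : T'.1 = {a', c', b'} := by rw [hT', Finset.pair_comm]
  have h1 := card_link_inter_link_le_one hT hT' hab hne h.1
  have h2 := card_link_inter_link_le_one hT hTs' hab hne h.2
  have h3 := card_link_inter_link_le_one hTs hT' hac hne h.1
  have h4 := card_link_inter_link_le_one hTs hTs' hac hne h.2
  unfold rivals
  rw [Finset.union_inter_distrib_right, Finset.inter_union_distrib_left,
    Finset.inter_union_distrib_left]
  have e1 := Finset.card_union_le (link a b {c} ∩ link a' b' {c'}) (link a b {c} ∩ link a' c' {b'})
  have e2 := Finset.card_union_le (link a c {b} ∩ link a' b' {c'}) (link a c {b} ∩ link a' c' {b'})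
  exact (Finset.card_union_le _ _).trans (by omega)

/-! ### Copies of `M` in terms of birth times. -/

theorem mem_complexAt {n : ℕ} {β : Triple n → ℝ} {p : ℝ} {A : Finset (Fin n)} :
    A ∈ complexAt β p ↔ A.Nonempty ∧ ∃ T : Triple n, β T ≤ p ∧ A ⊆ T.1 := by
  change (A.Nonempty ∧ ∃ B ∈ {A | ∃ T : Triple n, T.1 = A ∧ β T ≤ p}, A ⊆ B) ↔ _
  constructor
  · rintro ⟨h, _, ⟨T, rfl, hT⟩, hA⟩
    exact ⟨h, T, hT, hA⟩
  · rintro ⟨h, T, hT, hA⟩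
    exact ⟨h, T.1, ⟨T, rfl, hT⟩, hA⟩

theorem isFace_complexAt {n : ℕ} {β : Triple n → ℝ} {p : ℝ} (T : Triple n) :
    IsFace (complexAt β p) T.1 ↔ β T ≤ p := by
  unfold IsFace
  rw [mem_complexAt]
  constructor
  · rintro ⟨⟨-, S, hS, hTS⟩, -⟩
    have : T = S := Subtype.ext (Finset.eq_of_subset_of_card_le hTS (by rw [T.2, S.2]))
    rwa [this]
  · intro h
    exact ⟨⟨Finset.card_pos.1 (by rw [T.2]; norm_num), T, h, subset_rfl⟩, T.2⟩

/-- A copy of `M` forces all triples sharing one of its two free edges to be born later. -/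
theorem IsCopyM.lt_birth {n : ℕ} {β : Triple n → ℝ} {p : ℝ} {a b c : Fin n}
    (h : IsCopyM (complexAt β p) a b c) :
    (a ≠ b ∧ a ≠ c ∧ b ≠ c) ∧ ∃ T : Triple n, T.1 = {a, b, c} ∧ β T ≤ p ∧
      ∀ S ∈ rivals a b c, p < β S := by
  obtain ⟨hF, h1, h2, -⟩ := h
  have hdist : a ≠ b ∧ a ≠ c ∧ b ≠ c := by
    have h3 := hF.2
    refine ⟨?_, ?_, ?_⟩
    · rintro rfl
      rw [Finset.insert_eq_of_mem (by simp)] at h3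
      exact absurd h3 (by have := Finset.card_le_two (a := a) (b := c); omega)
    · rintro rfl
      rw [Finset.insert_eq_of_mem (by simp)] at h3
      exact absurd h3 (by have := Finset.card_le_two (a := b) (b := a); omega)
    · rintro rfl
      rw [Finset.pair_eq_singleton] at h3
      exact absurd h3 (by have := Finset.card_le_two (a := a) (b := b); omega)
  refine ⟨hdist, ⟨{a, b, c}, hF.2⟩, rfl, (isFace_complexAt _).1 hF, fun S hS => ?_⟩
  by_contra hle
  have hface := (isFace_complexAt S).2 (not_lt.1 hle)
  obtain ⟨hne, hsub⟩ := subset_of_mem_rivals hS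
  rcases hsub with hsub | hsub
  · exact hne (h1 _ hface hsub)
  · exact hne (h2 _ hface hsub)

/-- The path `a`-`x`-`b` avoids `ab` and `ac` because `x` lies outside the triple, so the path
condition reduces to `ax` and `xb` being covered. -/
theorem isCopyM_of_births {n : ℕ} {β : Triple n → ℝ} {p : ℝ} {a b c x : Fin n} {T : Triple n}
    (hT : T.1 = {a, b, c}) (hab : a ≠ b) (hac : a ≠ c) (hbc : b ≠ c) (hxa : x ≠ a) (hxb : x ≠ b)
    (hxc : x ≠ c) (hTp : β T ≤ p) (hriv : ∀ S ∈ rivals a b c, p < β S)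
    (hax : ∃ S : Triple n, a ∈ S.1 ∧ x ∈ S.1 ∧ β S ≤ p)
    (hbx : ∃ S : Triple n, b ∈ S.1 ∧ x ∈ S.1 ∧ β S ≤ p) :
    IsCopyM (complexAt β p) a b c := by
  have hfree : ∀ F : Finset (Fin n), IsFace (complexAt β p) F →
      (({a, b} : Finset (Fin n)) ⊆ F ∨ ({a, c} : Finset (Fin n)) ⊆ F) → F = {a, b, c} := by
    intro F hF hsub
    by_contra hne
    have h1 := hriv ⟨F, hF.2⟩ (mem_rivals_of_subset hab hac hbc hne hsub)
    exact absurd ((isFace_complexAt ⟨F, hF.2⟩).1 hF) (not_le.2 h1)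
  have hadj1 : (shadow (complexAt β p)).Adj a x := by
    obtain ⟨S, h1, h2, h3⟩ := hax
    refine ⟨hxa.symm, mem_complexAt.2 ⟨by simp, S, h3, ?_⟩⟩
    simp [Finset.insert_subset_iff, h1, h2]
  have hadj2 : (shadow (complexAt β p)).Adj x b := by
    obtain ⟨S, h1, h2, h3⟩ := hbx
    refine ⟨hxb, mem_complexAt.2 ⟨by simp, S, h3, ?_⟩⟩
    simp [Finset.insert_subset_iff, h1, h2]
  refine ⟨hT ▸ (isFace_complexAt T).2 hTp, fun F hF h => hfree F hF (Or.inl h),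
    fun F hF h => hfree F hF (Or.inr h), .cons hadj1 (.cons hadj2 .nil), ?_, ?_, ?_⟩
  · simp [SimpleGraph.Walk.cons_isPath_iff, hxb, hab, hxa.symm]
  · simp [hab, hxa.symm, hxb.symm]
  · simp [hab, hxa.symm, hxc.symm]

/-! ### The birth destroying the last copy. -/

theorem complexAt_congr {n : ℕ} {β : Triple n → ℝ} {p q : ℝ} (h : ∀ T, β T ≤ p ↔ β T ≤ q) :
    complexAt β p = complexAt β q := by
  simp only [complexAt, h]

theorem complexBefore_eq_complexAt {n : ℕ} {β : Triple n → ℝ} {p q : ℝ}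
    (h : ∀ T, β T < p ↔ β T ≤ q) : complexBefore β p = complexAt β q := by
  simp only [complexAt, complexBefore, h]

/-- If `M` is present at time `p` and absent from time `q` on, then its last copy is destroyed by a
birth between the times `p` and `q`. -/
theorem exists_destroysLastM {n : ℕ} {β : Triple n → ℝ} {p q : ℝ}
    (hp : ContainsM (complexAt β p)) (hq : ∀ r, q ≤ r → ¬ ContainsM (complexAt β r)) :
    ∃ T : Triple n, DestroysLastM β T ∧ p ≤ β T ∧ β T ≤ q := by
  -- The complex is constant between births, so a copy present at time `r` survives until just
  -- before the next birth. There is a next birth, since otherwise the copy would persist past `q`.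
  have next : ∀ r, ContainsM (complexAt β r) →
      ∃ T : Triple n, r < β T ∧ ContainsM (complexBefore β (β T)) := by
    intro r hr
    have hne : (Finset.univ.filter fun T : Triple n => r < β T).Nonempty := by
      by_contra hemp
      rw [Finset.not_nonempty_iff_eq_empty, Finset.filter_eq_empty_iff] at hemp
      have hall : ∀ T, β T ≤ r := fun T => not_lt.1 (hemp (Finset.mem_univ T))
      refine hq (max q r) (le_max_left _ _) ?_
      rwa [complexAt_congr (q := r) fun T => ⟨fun _ => hall T, fun h => h.trans (le_max_right _ _)⟩]
    obtain ⟨T, hT, hmin⟩ := Finset.exists_min_image _ β hne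
    simp only [Finset.mem_filter, Finset.mem_univ, true_and] at hT hmin
    refine ⟨T, hT, ?_⟩
    rwa [complexBefore_eq_complexAt (q := r)]
    exact fun S => ⟨fun h => not_lt.1 fun h' => (hmin S h').not_gt h, fun h => h.trans_lt hT⟩
  obtain ⟨T₀, hT₀, hM₀⟩ := next p hp
  classical
  obtain ⟨T, hT, hmax⟩ := Finset.exists_max_image
    (Finset.univ.filter fun T : Triple n => ContainsM (complexBefore β (β T))) β
    ⟨T₀, by simpa using hM₀⟩
  simp only [Finset.mem_filter, Finset.mem_univ, true_and] at hT hmax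
  refine ⟨T, ⟨hT, fun r hr hM => ?_⟩, hT₀.le.trans (hmax T₀ hM₀), ?_⟩
  · obtain ⟨S, hS, hSM⟩ := next r hM
    exact (hmax S hSM).not_gt (hr.trans_lt hS)
  · by_contra hlt
    rw [not_le] at hlt
    -- Take `r` to be the maximum of `q` and the birth times before `β T`; the complex just before
    -- `β T` is then the complex at a time at least `q`.
    obtain ⟨r, hr, hrT⟩ : ∃ r, q ≤ r ∧ ∀ S, β S < β T ↔ β S ≤ r := by
      obtain ⟨r, hr, hmaxr⟩ := Finset.exists_max_image
        (insert q ((Finset.univ.filter fun S : Triple n => β S < β T).image β)) id (by simp)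
      refine ⟨r, hmaxr q (by simp), fun S => ⟨fun h => hmaxr (β S) ?_, fun h => h.trans_lt ?_⟩⟩
      · exact Finset.mem_insert_of_mem (Finset.mem_image_of_mem _ (by simpa using h))
      · rcases Finset.mem_insert.1 hr with rfl | hr
        · exact hlt
        · obtain ⟨S', hS', rfl⟩ := Finset.mem_image.1 hr
          simpa using hS'
    rw [complexBefore_eq_complexAt hrT] at hT
    exact hq r hr hT

/-! ### Second moment inequality. -/

/-- The second moment bound for the probability that none of a family of events occurs. -/
theorem measureReal_iInter_compl_le {Ω ι : Type*} [MeasurableSpace Ω] (P : Measure Ω)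
    [IsProbabilityMeasure P] (s : Finset ι) (hs : s.Nonempty) (A : ι → Set Ω)
    (hA : ∀ i, MeasurableSet (A i)) {q r : ℝ} (hq : 0 < q) (hAq : ∀ i ∈ s, P.real (A i) = q)
    (hr : 0 ≤ r) (hAr : ∀ i ∈ s, ∀ j ∈ s, i ≠ j → P.real (A i ∩ A j) ≤ r) :
    P.real {x | ∀ i ∈ s, x ∉ A i} ≤ 1 / (s.card * q) + (r / q ^ 2 - 1) := by
  classical
  set N : ℝ := (s.card : ℝ)
  have hN : 0 < N := by simpa [N] using hs.card_pos
  set f : ι → Ω → ℝ := fun i => (A i).indicator 1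
  have hf : ∀ i, Integrable (f i) P := fun i => (integrable_const (1 : ℝ)).indicator (hA i)
  have hff : ∀ i j x, f i x * f j x = (A i ∩ A j).indicator (1 : Ω → ℝ) x := by
    intro i j x
    rw [Set.inter_indicator_one]
    rfl
  have hfg : ∀ i j, Integrable (fun x => f i x * f j x) P := by
    intro i j
    simp only [hff]
    exact (integrable_const (1 : ℝ)).indicator ((hA i).inter (hA j))
  have hint : ∀ i ∈ s, ∫ x, f i x ∂P = q := by
    intro i hi
    rw [← hAq i hi]
    exact integral_indicator_one (hA i)
  have hint2 : ∀ i j, ∫ x, f i x * f j x ∂P = P.real (A i ∩ A j) := by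
    intro i j
    simp only [hff]
    exact integral_indicator_one ((hA i).inter (hA j))
  have hexpand : ∀ x, (∑ i ∈ s, f i x - N * q) ^ 2 =
      ∑ i ∈ s, ∑ j ∈ s, f i x * f j x - 2 * (N * q) * ∑ i ∈ s, f i x + (N * q) ^ 2 := by
    intro x
    rw [← Finset.sum_mul_sum]
    ring
  have i1 : Integrable (fun x => ∑ i ∈ s, ∑ j ∈ s, f i x * f j x) P :=
    integrable_finsetSum _ fun i _ => integrable_finsetSum _ fun j _ => hfg i j
  have i2 : Integrable (fun x => 2 * (N * q) * ∑ i ∈ s, f i x) P :=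
    (integrable_finsetSum _ fun i _ => hf i).const_mul _
  have i12 : Integrable (fun x => ∑ i ∈ s, ∑ j ∈ s, f i x * f j x -
      2 * (N * q) * ∑ i ∈ s, f i x) P := i1.sub i2
  have hvar : ∫ x, (∑ i ∈ s, f i x - N * q) ^ 2 ∂P ≤ N * q + N ^ 2 * r - (N * q) ^ 2 := by
    simp only [hexpand]
    rw [integral_add i12 (integrable_const _), integral_sub i1 i2, integral_const_mul,
      integral_finsetSum _ fun i _ => hf i, Finset.sum_congr rfl hint,
      integral_finsetSum _ fun i _ => integrable_finsetSum _ fun j _ => hfg i j]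
    have hdouble : ∑ i ∈ s, ∫ x, ∑ j ∈ s, f i x * f j x ∂P ≤ ∑ i ∈ s, (q + N * r) := by
      refine Finset.sum_le_sum fun i hi => ?_
      rw [integral_finsetSum _ fun j _ => hfg i j]
      simp only [hint2]
      rw [← Finset.add_sum_erase s _ hi, Set.inter_self, hAq i hi]
      have h1 : ∑ j ∈ s.erase i, P.real (A i ∩ A j) ≤ ∑ j ∈ s.erase i, r :=
        Finset.sum_le_sum fun j hj =>
          hAr i hi j (Finset.mem_of_mem_erase hj) (Finset.ne_of_mem_erase hj).symm
      -- Counting `N` off-diagonal terms instead of `N - 1` gives the cleaner bound.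
      have h2 : ∑ j ∈ s.erase i, r ≤ ∑ j ∈ s, r :=
        Finset.sum_le_sum_of_subset_of_nonneg (Finset.erase_subset _ _) fun _ _ _ => hr
      have h3 : ∑ j ∈ s, r = N * r := by rw [Finset.sum_const, nsmul_eq_mul]
      linarith
    simp only [Finset.sum_const, nsmul_eq_mul, integral_const, probReal_univ, smul_eq_mul] at hdouble ⊢
    have : (s.card : ℝ) = N := rfl
    rw [this] at hdouble ⊢
    nlinarith
  have hi3 : Integrable (fun x => (∑ i ∈ s, f i x - N * q) ^ 2) P := by
    simp only [hexpand]
    exact i12.add (integrable_const _)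
  have hmarkov := mul_meas_ge_le_integral_of_nonneg
    (Eventually.of_forall fun x => sq_nonneg (∑ i ∈ s, f i x - N * q)) hi3 ((N * q) ^ 2)
  -- If no event occurs, the count is `0` and its squared deviation from the mean is exactly `(N *
  -- q) ^ 2`.
  have hsub : P.real {x | ∀ i ∈ s, x ∉ A i} ≤
      P.real {x | (N * q) ^ 2 ≤ (∑ i ∈ s, f i x - N * q) ^ 2} := by
    refine measureReal_mono fun x hx => ?_
    have h0 : ∑ i ∈ s, f i x = 0 := Finset.sum_eq_zero fun i hi => by
      simp [f, hx i hi]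
    simp [h0]
  have hpos : 0 < (N * q) ^ 2 := by positivity
  have hfin : P.real {x | ∀ i ∈ s, x ∉ A i} ≤ (N * q + N ^ 2 * r - (N * q) ^ 2) / (N * q) ^ 2 := by
    rw [le_div_iff₀ hpos, mul_comm]
    exact (mul_le_mul_of_nonneg_left hsub hpos.le).trans (hmarkov.trans hvar)
  refine hfin.trans (le_of_eq ?_)
  field_simp
  ring

/-! ### Uniform and independent birth times. -/

/-- The uniform law on `[0, 1]`. -/
noncomputable abbrev uniformLaw : Measure ℝ := (volume : Measure ℝ).restrict (Set.Icc 0 1)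

instance : IsProbabilityMeasure uniformLaw := ⟨by simp [uniformLaw]⟩

theorem uniformLaw_Iic {p : ℝ} (h1 : p ≤ 1) : uniformLaw.real (Set.Iic p) = max p 0 := by
  rw [measureReal_restrict_apply measurableSet_Iic]
  have : Set.Iic p ∩ Set.Icc 0 1 = Set.Icc 0 p := by
    ext x
    simp only [Set.mem_inter_iff, Set.mem_Iic, Set.mem_Icc]
    constructor
    · rintro ⟨h, h', -⟩
      exact ⟨h', h⟩
    · rintro ⟨h, h'⟩
      exact ⟨h', h, h'.trans h1⟩
  rw [this, Measure.real, Real.volume_Icc, sub_zero, ENNReal.toReal_ofReal']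

theorem uniformLaw_Ioi {p : ℝ} (h0 : 0 ≤ p) : uniformLaw.real (Set.Ioi p) = max (1 - p) 0 := by
  rw [measureReal_restrict_apply measurableSet_Ioi]
  have : Set.Ioi p ∩ Set.Icc 0 1 = Set.Ioc p 1 := by
    ext x
    simp only [Set.mem_inter_iff, Set.mem_Ioi, Set.mem_Icc, Set.mem_Ioc]
    constructor
    · rintro ⟨h, -, h'⟩
      exact ⟨h, h'⟩
    · rintro ⟨h, h'⟩
      exact ⟨h, h0.trans h.le, h'⟩
  rw [this, Measure.real, Real.volume_Ioc, ENNReal.toReal_ofReal']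

theorem uniformLaw_Ioi_le_exp {p : ℝ} (h0 : 0 ≤ p) :
    uniformLaw.real (Set.Ioi p) ≤ Real.exp (-p) := by
  rw [uniformLaw_Ioi h0]
  exact max_le (Real.one_sub_le_exp_neg p) (Real.exp_pos _).le

theorem uniformLaw_Icc_le {u v : ℝ} (huv : u ≤ v) : uniformLaw.real (Set.Icc u v) ≤ v - u := by
  rw [Measure.real]
  refine ENNReal.toReal_le_of_le_ofReal (sub_nonneg.2 huv) ?_
  rw [← Real.volume_Icc]
  exact Measure.restrict_apply_le _ _

/-- The birth times of the triples in two disjoint families are independent. -/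
theorem birthLaw_box {n : ℕ} {A B : Finset (Triple n)} (hAB : Disjoint A B) (U W : Set ℝ) :
    (birthLaw n).real {β | (∀ T ∈ A, β T ∈ U) ∧ ∀ S ∈ B, β S ∈ W} =
      uniformLaw.real U ^ A.card * uniformLaw.real W ^ B.card := by
  classical
  -- Unconstrained coordinates get `Set.univ`, of mass `1`. `Measure.pi_pi` holds for arbitrary
  -- sides, so `U` and `W` need not be measurable.
  have hset : {β : Triple n → ℝ | (∀ T ∈ A, β T ∈ U) ∧ ∀ S ∈ B, β S ∈ W} =
      Set.univ.pi fun T => if T ∈ A then U else if T ∈ B then W else Set.univ := by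
    ext β
    simp only [Set.mem_ofPred_eq, Set.mem_pi, Set.mem_univ, true_implies]
    constructor
    · rintro ⟨h1, h2⟩ T
      split_ifs with hA hB
      · exact h1 T hA
      · exact h2 T hB
      · trivial
    · intro h
      refine ⟨fun T hT => by simpa [hT] using h T, fun T hT => ?_⟩
      simpa [hT, Finset.disjoint_right.1 hAB hT] using h T
  rw [hset, Measure.real, birthLaw, Measure.pi_pi]
  have hprod : ∀ T : Triple n,
      uniformLaw (if T ∈ A then U else if T ∈ B then W else Set.univ) =
        (if T ∈ A then uniformLaw U else 1) * (if T ∈ B then uniformLaw W else 1) := by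
    intro T
    by_cases hA : T ∈ A
    · simp [hA, Finset.disjoint_left.1 hAB hA]
    · by_cases hB : T ∈ B <;> simp [hA, hB]
  rw [Finset.prod_congr rfl fun T _ => hprod T, Finset.prod_mul_distrib]
  simp [Finset.prod_ite_mem, Measure.real]

/-! ### First moment bound, uniform over later times. -/

theorem exp_neg_pow_le_half_pow {m n k : ℕ} (hn : 0 < n) (hmn : n ≤ m) :
    Real.exp (-(k / n : ℝ)) ^ m ≤ (1 / 2) ^ k := by
  have hn' : (0 : ℝ) < n := by exact_mod_cast hn
  have h1 : Real.exp (-(k / n : ℝ)) ^ m ≤ Real.exp (-(k / n : ℝ)) ^ n :=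
    pow_le_pow_of_le_one (Real.exp_pos _).le (Real.exp_le_one_iff.2 (by simp; positivity)) hmn
  have h2 : Real.exp (-(k / n : ℝ)) ^ n = Real.exp (-1) ^ k := by
    rw [← Real.exp_nat_mul, ← Real.exp_nat_mul]
    congr 1
    field_simp
  have h3 : Real.exp (-1) ≤ 1 / 2 := by
    rw [Real.exp_neg, ← one_div]
    exact one_div_le_one_div_of_le (by norm_num) (by linarith [Real.exp_one_gt_d9])
  exact h1.trans (h2.le.trans (pow_le_pow_left₀ (Real.exp_pos _).le h3 k))

/-- The uncountable union over `r` is discretised by the birth time of `T`: either `T` is born by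
`p`, or in a window of length `1 / n` after `p`. For the `k`-th window all of `R` is born after its
left end, which costs a further factor `(1 / 2) ^ k`; the geometric series produces the term `2 /
n`. -/
theorem birthLaw_late_rivals_le {n : ℕ} (hn : 6 ≤ n) {p : ℝ} (hp0 : 0 ≤ p) (hp1 : p ≤ 1)
    {T : Triple n} {R : Finset (Triple n)} (hTR : T ∉ R) (hR : R.card = 2 * (n - 3)) :
    (birthLaw n).real {β | ∃ r, p ≤ r ∧ β T ≤ r ∧ ∀ S ∈ R, r < β S} ≤
      (p + 2 / n) * Real.exp (-(p * (2 * n - 6))) := by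
  have hn' : (0 : ℝ) < n := by exact_mod_cast (by omega : 0 < n)
  have hdisj : Disjoint {T} R := Finset.disjoint_singleton_left.2 hTR
  have hm : ((2 * (n - 3) : ℕ) : ℝ) = 2 * n - 6 := by
    push_cast [Nat.cast_sub (by omega : 3 ≤ n)]
    ring
  set box : Set ℝ → ℝ → Set (Triple n → ℝ) := fun U t =>
    {β | (∀ T' ∈ ({T} : Finset (Triple n)), β T' ∈ U) ∧ ∀ S ∈ R, β S ∈ Set.Ioi t}
  set t : ℕ → ℝ := fun k => p + k / n
  have ht : ∀ k, 0 ≤ t k := fun k => by positivity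
  have hcover : {β : Triple n → ℝ | ∃ r, p ≤ r ∧ β T ≤ r ∧ ∀ S ∈ R, r < β S} ⊆
      (box (Set.Iic p) p ∪ ⋃ k ∈ Finset.range n, box (Set.Icc (t k) (t (k + 1))) (t k)) ∪
        box Set.univ (t n) := by
    rintro β ⟨r, hpr, hTr, hS⟩
    by_cases hT : β T ≤ p
    · exact Or.inl (Or.inl ⟨by simpa using hT, fun S h => hpr.trans_lt (hS S h)⟩)
    rw [not_le] at hT
    set k := ⌊(β T - p) * n⌋₊
    have hk1 : t k ≤ β T := by
      have h1 : (k : ℝ) ≤ (β T - p) * n := Nat.floor_le (mul_nonneg (sub_pos.2 hT).le hn'.le)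
      have h2 : (k : ℝ) / n ≤ β T - p := (div_le_iff₀ hn').2 h1
      simp only [t]
      linarith
    have hk2 : β T ≤ t (k + 1) := by
      have h1 : (β T - p) * n < k + 1 := Nat.lt_floor_add_one _
      have h2 : β T - p < (k + 1 : ℝ) / n := (lt_div_iff₀ hn').2 h1
      simp only [t]
      push_cast
      linarith
    by_cases hkn : k < n
    · refine Or.inl (Or.inr (Set.mem_biUnion (x := k) (by simpa using hkn) ⟨?_, ?_⟩))
      · simpa using And.intro hk1 hk2
      · exact fun S h => (hk1.trans hTr).trans_lt (hS S h)
    · refine Or.inr ⟨by simp, fun S h => lt_of_le_of_lt ?_ (hS S h)⟩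
      refine le_trans ?_ (hk1.trans hTr)
      have : (n : ℝ) ≤ k := by exact_mod_cast not_lt.1 hkn
      simp only [t]
      gcongr
  have hbox : ∀ U s, (birthLaw n).real (box U s) =
      uniformLaw.real U * uniformLaw.real (Set.Ioi s) ^ (2 * (n - 3)) := by
    intro U s
    rw [birthLaw_box hdisj, Finset.card_singleton, pow_one, hR]
  have hexp : ∀ s, 0 ≤ s → uniformLaw.real (Set.Ioi s) ^ (2 * (n - 3)) ≤
      Real.exp (-s) ^ (2 * (n - 3)) := fun s hs =>
    pow_le_pow_left₀ measureReal_nonneg (uniformLaw_Ioi_le_exp hs) _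
  have hexpp : Real.exp (-p) ^ (2 * (n - 3)) = Real.exp (-(p * (2 * n - 6))) := by
    rw [← Real.exp_nat_mul, hm]
    congr 1
    ring
  have h1 : (birthLaw n).real (box (Set.Iic p) p) ≤ p * Real.exp (-(p * (2 * n - 6))) := by
    rw [hbox, uniformLaw_Iic hp1, max_eq_left hp0, ← hexpp]
    exact mul_le_mul_of_nonneg_left (hexp p hp0) hp0
  have h2 : ∀ k, (birthLaw n).real (box (Set.Icc (t k) (t (k + 1))) (t k)) ≤
      (1 / 2) ^ k * (1 / n * Real.exp (-(p * (2 * n - 6)))) := by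
    intro k
    rw [hbox]
    have hu : uniformLaw.real (Set.Icc (t k) (t (k + 1))) ≤ 1 / n := by
      have hdiff : t (k + 1) - t k = 1 / n := by
        simp only [t]
        push_cast
        ring
      rw [← hdiff]
      refine uniformLaw_Icc_le ?_
      rw [← sub_nonneg, hdiff]
      positivity
    have he : uniformLaw.real (Set.Ioi (t k)) ^ (2 * (n - 3)) ≤
        Real.exp (-(p * (2 * n - 6))) * (1 / 2) ^ k := by
      refine (hexp _ (ht k)).trans ?_
      have : Real.exp (-t k) = Real.exp (-p) * Real.exp (-(k / n : ℝ)) := by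
        rw [← Real.exp_add]
        congr 1
        simp only [t]
        ring
      rw [this, mul_pow, hexpp]
      -- Here `6 ≤ n` gives `n ≤ 2 * (n - 3)`.
      exact mul_le_mul_of_nonneg_left (exp_neg_pow_le_half_pow (by omega) (by omega))
        (Real.exp_pos _).le
    calc _ ≤ 1 / (n : ℝ) * (Real.exp (-(p * (2 * n - 6))) * (1 / 2) ^ k) :=
          mul_le_mul hu he (by positivity) (by positivity)
      _ = _ := by ring
  -- Since `t n = p + 1 ≥ 1`, almost surely no birth comes later.
  have h3 : (birthLaw n).real (box Set.univ (t n)) = 0 := by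
    rw [hbox, uniformLaw_Ioi (ht n), max_eq_right, zero_pow (by omega), mul_zero]
    simp only [t]
    rw [div_self hn'.ne']
    linarith
  have h4 : (birthLaw n).real
      (⋃ k ∈ Finset.range n, box (Set.Icc (t k) (t (k + 1))) (t k)) ≤
        2 * (1 / n * Real.exp (-(p * (2 * n - 6)))) := by
    refine (measureReal_biUnion_finset_le _ _).trans ((Finset.sum_le_sum fun k _ => h2 k).trans ?_)
    rw [← Finset.sum_mul]
    refine mul_le_mul_of_nonneg_right ?_ (by positivity)
    exact sum_le_hasSum _ (fun k _ => by positivity) hasSum_geometric_two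
  refine (measureReal_mono hcover).trans ((measureReal_union_le _ _).trans ?_)
  have h5 := measureReal_union_le (μ := birthLaw n) (box (Set.Iic p) p)
    (⋃ k ∈ Finset.range n, box (Set.Icc (t k) (t (k + 1))) (t k))
  have h6 : p * Real.exp (-(p * (2 * n - 6))) + 2 * (1 / n * Real.exp (-(p * (2 * n - 6)))) =
      (p + 2 / n) * Real.exp (-(p * (2 * n - 6))) := by ring
  linarith

/-- The first moment bound for the presence of a copy of `M` at some time from `p` on. -/
theorem birthLaw_containsM_le {n : ℕ} (hn : 6 ≤ n) {p : ℝ} (hp0 : 0 ≤ p) (hp1 : p ≤ 1) :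
    (birthLaw n).real {β | ∃ r, p ≤ r ∧ ContainsM (complexAt β r)} ≤
      (n : ℝ) ^ 3 * ((p + 2 / n) * Real.exp (-(p * (2 * n - 6)))) := by
  set E : Fin n × Fin n × Fin n → Set (Triple n → ℝ) := fun v =>
    {β | ∃ r, p ≤ r ∧ IsCopyM (complexAt β r) v.1 v.2.1 v.2.2}
  have hcover : {β : Triple n → ℝ | ∃ r, p ≤ r ∧ ContainsM (complexAt β r)} ⊆ ⋃ v, E v := by
    rintro β ⟨r, hr, a, b, c, h⟩
    exact Set.mem_iUnion.2 ⟨(a, b, c), r, hr, h⟩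
  have hE : ∀ v, (birthLaw n).real (E v) ≤ (p + 2 / n) * Real.exp (-(p * (2 * n - 6))) := by
    rintro ⟨a, b, c⟩
    by_cases hd : a ≠ b ∧ a ≠ c ∧ b ≠ c
    · obtain ⟨hab, hac, hbc⟩ := hd
      let T : Triple n := ⟨{a, b, c}, Finset.card_eq_three.2 ⟨a, b, c, hab, hac, hbc, rfl⟩⟩
      refine (measureReal_mono ?_).trans (birthLaw_late_rivals_le hn hp0 hp1 (T := T)
        (fun h => (subset_of_mem_rivals h).1 rfl) (card_rivals hab hac hbc))
      rintro β ⟨r, hr, hM⟩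
      obtain ⟨-, S, hS, hSr, hriv⟩ := hM.lt_birth
      have : S = T := Subtype.ext hS
      exact ⟨r, hr, this ▸ hSr, hriv⟩
    · have : E (a, b, c) = ∅ := by
        rw [Set.eq_empty_iff_forall_notMem]
        rintro β ⟨r, -, hM⟩
        exact hd hM.lt_birth.1
      rw [this, measureReal_empty]
      positivity
  refine (measureReal_mono hcover).trans ((measureReal_iUnion_fintype_le _).trans
    ((Finset.sum_le_sum fun v _ => hE v).trans (le_of_eq ?_)))
  simp only [Finset.sum_const, Finset.card_univ, Fintype.card_prod, Fintype.card_fin, nsmul_eq_mul]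
  push_cast
  ring

/-! ### Second moment bound at a fixed time. -/

/-- The probability that the triple `T` is born by time `p`, all of `R` being born later. -/
theorem birthLaw_isolated {n : ℕ} {A R : Finset (Triple n)} (hAR : Disjoint A R) {p : ℝ}
    (hp0 : 0 ≤ p) (hp1 : p ≤ 1) :
    (birthLaw n).real {β | (∀ T ∈ A, β T ≤ p) ∧ ∀ S ∈ R, p < β S} =
      p ^ A.card * (1 - p) ^ R.card := by
  have h := birthLaw_box hAR (Set.Iic p) (Set.Ioi p)
  rwa [uniformLaw_Iic hp1, uniformLaw_Ioi hp0, max_eq_left hp0, max_eq_left (sub_nonneg.2 hp1)] at h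

/-- The second moment bound for the absence of copies of `M` at time `p`. -/
theorem birthLaw_not_containsM_le {n : ℕ} (hn : 4 ≤ n) {p : ℝ} (hp0 : 0 < p) (hp1 : p < 1) :
    (birthLaw n).real {β | ¬ ContainsM (complexAt β p)} ≤
      1 / (n.choose 3 * (p * (1 - p) ^ (2 * (n - 3)))) + (((1 - p) ^ 4)⁻¹ - 1) +
        n.choose 3 * (2 * (p * (1 - p) ^ (2 * (n - 3)) * (1 - p) ^ (n - 4))) := by
  have hq1 : 0 < 1 - p := sub_pos.2 hp1
  have hq1' : 1 - p ≤ 1 := by linarith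
  have hchoice : ∀ T : Triple n, ∃ a b c x : Fin n, T.1 = {a, b, c} ∧ a ≠ b ∧ a ≠ c ∧ b ≠ c ∧
      x ≠ a ∧ x ≠ b ∧ x ≠ c := by
    intro T
    obtain ⟨a, b, c, hab, hac, hbc, hT⟩ := Finset.card_eq_three.1 T.2
    obtain ⟨x, hx⟩ : ∃ x, x ∉ T.1 := by
      by_contra! hall
      have h1 := T.2
      rw [Finset.eq_univ_iff_forall.2 hall, Finset.card_univ, Fintype.card_fin] at h1
      omega
    rw [hT] at hx
    simp only [Finset.mem_insert, Finset.mem_singleton, not_or] at hx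
    exact ⟨a, b, c, x, hT, hab, hac, hbc, hx.1, hx.2.1, hx.2.2⟩
  -- One labelling and one outside vertex per triple suffice for a lower bound.
  choose a b c x hT hab hac hbc hxa hxb hxc using hchoice
  set R : Triple n → Finset (Triple n) := fun T => rivals (a T) (b T) (c T)
  have hR : ∀ T, (R T).card = 2 * (n - 3) := fun T => card_rivals (hab T) (hac T) (hbc T)
  have hTR : ∀ T, T ∉ R T := fun T h => (subset_of_mem_rivals h).1 (hT T)
  set A : Triple n → Set (Triple n → ℝ) := fun T =>
    {β | (∀ T' ∈ ({T} : Finset (Triple n)), β T' ≤ p) ∧ ∀ S ∈ R T, p < β S}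
  have hmemA : ∀ T β, β ∈ A T ↔ β T ≤ p ∧ ∀ S ∈ R T, p < β S := by
    intro T β
    simp [A]
  set q := p * (1 - p) ^ (2 * (n - 3)) with hq_def
  have hq : 0 < q := by positivity
  have hAq : ∀ T, (birthLaw n).real (A T) = q := by
    intro T
    rw [birthLaw_isolated (Finset.disjoint_singleton_left.2 (hTR T)) hp0.le hp1.le, hR]
    simp [q]
  have hAmeas : ∀ T, MeasurableSet (A T) := by
    intro T
    have : A T = {β | β T ≤ p} ∩ ⋂ S ∈ R T, {β | p < β S} := by
      ext β
      simp [hmemA]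
    rw [this]
    refine (measurableSet_le (measurable_pi_apply T) measurable_const).inter ?_
    exact Finset.measurableSet_biInter _ fun S _ =>
      measurableSet_lt measurable_const (measurable_pi_apply S)
  have hAA : ∀ T ∈ Finset.univ, ∀ T' ∈ Finset.univ, T ≠ T' →
      (birthLaw n).real (A T ∩ A T') ≤ q ^ 2 * ((1 - p) ^ 4)⁻¹ := by
    intro T _ T' _ hne
    -- If one triple is a rival of the other, it would have to be born both by time `p` and after
    -- it.
    by_cases hcl : T ∈ R T' ∨ T' ∈ R T
    · have : A T ∩ A T' = ∅ := by
        rw [Set.eq_empty_iff_forall_notMem]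
        rintro β ⟨h1, h2⟩
        rw [hmemA] at h1 h2
        rcases hcl with h | h
        · exact (h2.2 _ h).not_ge h1.1
        · exact (h1.2 _ h).not_ge h2.1
      rw [this, measureReal_empty]
      positivity
    rw [not_or] at hcl
    have hset : A T ∩ A T' ⊆ {β | (∀ T'' ∈ ({T, T'} : Finset (Triple n)), β T'' ≤ p) ∧
        ∀ S ∈ R T ∪ R T', p < β S} := by
      rintro β ⟨h1, h2⟩
      rw [hmemA] at h1 h2
      refine ⟨by simp [h1.1, h2.1], fun S hS => ?_⟩
      rcases Finset.mem_union.1 hS with h | h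
      · exact h1.2 S h
      · exact h2.2 S h
    have hdisj : Disjoint ({T, T'} : Finset (Triple n)) (R T ∪ R T') := by
      simp [hTR, hcl.1, hcl.2]
    have hcard : 2 * (2 * (n - 3)) ≤ (R T ∪ R T').card + 4 := by
      have h1 := Finset.card_union_add_card_inter (R T) (R T')
      have h2 := card_rivals_inter_rivals_le (hT T) (hT T') (hab T) (hac T) hne hcl.1
      rw [hR, hR] at h1
      have h3 : (R T ∩ R T').card ≤ 4 := h2
      omega
    refine (measureReal_mono hset).trans ?_
    rw [birthLaw_isolated hdisj hp0.le hp1.le, Finset.card_pair hne, ← div_eq_mul_inv,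
      le_div_iff₀ (by positivity), mul_assoc, ← pow_add, hq_def, mul_pow, ← pow_mul]
    refine mul_le_mul_of_nonneg_left ?_ (by positivity)
    exact pow_le_pow_of_le_one hq1.le hq1' (by omega)
  have hcardT : (Finset.univ : Finset (Triple n)).card = n.choose 3 := by
    rw [Finset.card_univ, Fintype.card_finset_len, Fintype.card_fin]
  have hnonempty : (Finset.univ : Finset (Triple n)).Nonempty := by
    rw [← Finset.card_pos, hcardT]
    exact Nat.choose_pos (by omega)
  have hsecond := measureReal_iInter_compl_le (birthLaw n) Finset.univ hnonempty A hAmeas hq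
    (fun T _ => hAq T) (by positivity) hAA
  rw [hcardT, mul_div_cancel_left₀ _ (by positivity)] at hsecond
  -- These are the failures of `ax` and `bx` to be covered. Leaving out `b` and `c` for `ax`, and
  -- `a` for `bx`, keeps the triples involved disjoint from the rivals, so the factor `(1 - p) ^ (n
  -- - 4)` is independent of `A T`.
  set B₁ : Triple n → Set (Triple n → ℝ) := fun T => {β | β ∈ A T ∧
    ∀ S ∈ link (a T) (x T) {b T, c T}, p < β S}
  set B₂ : Triple n → Set (Triple n → ℝ) := fun T => {β | β ∈ A T ∧
    ∀ S ∈ link (b T) (x T) {a T}, p < β S}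
  have hB : ∀ T (D : Finset (Triple n)), T ∉ D → Disjoint (R T) D → n - 4 ≤ D.card →
      (birthLaw n).real {β | β ∈ A T ∧ ∀ S ∈ D, p < β S} ≤ q * (1 - p) ^ (n - 4) := by
    intro T D hTD hRD hD
    have hset : {β | β ∈ A T ∧ ∀ S ∈ D, p < β S} ⊆
        {β | (∀ T' ∈ ({T} : Finset (Triple n)), β T' ≤ p) ∧ ∀ S ∈ R T ∪ D, p < β S} := by
      rintro β ⟨h1, h2⟩
      rw [hmemA] at h1
      refine ⟨by simp [h1.1], fun S hS => ?_⟩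
      rcases Finset.mem_union.1 hS with h | h
      · exact h1.2 S h
      · exact h2 S h
    refine (measureReal_mono hset).trans ?_
    rw [birthLaw_isolated (by simp [hTR, hTD]) hp0.le hp1.le, Finset.card_singleton, pow_one,
      Finset.card_union_of_disjoint hRD, hR, pow_add, ← mul_assoc]
    exact mul_le_mul_of_nonneg_left (pow_le_pow_of_le_one hq1.le hq1' hD) hq.le
  have hB₁ : ∀ T, (birthLaw n).real (B₁ T) ≤ q * (1 - p) ^ (n - 4) := by
    intro T
    refine hB T _ ?_ ?_ ?_
    · simp [mem_link, hT T, hxa, hxb, hxc]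
    · rw [Finset.disjoint_left]
      intro S h1 h2
      simp only [R, rivals, Finset.mem_union, mem_link, Finset.disjoint_insert_right,
        Finset.disjoint_singleton_right] at h1 h2
      tauto
    · rw [card_link (hxa T).symm (by simp [hab, hac]) (by simp [hxb, hxc]),
        Finset.card_pair (hbc T)]
      omega
  have hB₂ : ∀ T, (birthLaw n).real (B₂ T) ≤ q * (1 - p) ^ (n - 4) := by
    intro T
    refine hB T _ ?_ ?_ ?_
    · simp [mem_link, hT T]
    · rw [Finset.disjoint_left]
      intro S h1 h2
      simp only [R, rivals, Finset.mem_union, mem_link, Finset.disjoint_singleton_right] at h1 h2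
      tauto
    · rw [card_link (hxb T).symm (by simp [(hab T).symm]) (by simp [hxa]),
        Finset.card_singleton]
      omega
  have hcover : {β : Triple n → ℝ | ¬ ContainsM (complexAt β p)} ⊆
      {β | ∀ T ∈ Finset.univ, β ∉ A T} ∪ ⋃ T, (B₁ T ∪ B₂ T) := by
    intro β hβ
    by_contra hnot
    simp only [Set.mem_union, Set.mem_ofPred_eq, Set.mem_iUnion, not_or, not_exists,
      Finset.mem_univ, true_implies, not_forall, not_not] at hnot
    obtain ⟨⟨T, hTA⟩, hgood⟩ := hnot
    obtain ⟨h1, h2⟩ := hgood T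
    have hA := (hmemA T β).1 hTA
    refine hβ ⟨a T, b T, c T, isCopyM_of_births (hT T) (hab T) (hac T) (hbc T) (hxa T) (hxb T)
      (hxc T) hA.1 hA.2 ?_ ?_⟩
    · by_contra! hno
      exact h1 ⟨hTA, fun S hS => hno S (mem_link.1 hS).1 (mem_link.1 hS).2.1⟩
    · by_contra! hno
      exact h2 ⟨hTA, fun S hS => hno S (mem_link.1 hS).1 (mem_link.1 hS).2.1⟩
  have hunion : (birthLaw n).real (⋃ T, (B₁ T ∪ B₂ T)) ≤
      n.choose 3 * (2 * (q * (1 - p) ^ (n - 4))) := by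
    refine (measureReal_iUnion_fintype_le _).trans ((Finset.sum_le_sum (g := fun _ =>
      2 * (q * (1 - p) ^ (n - 4))) fun T _ => ?_).trans ?_)
    · exact (measureReal_union_le _ _).trans (by linarith [hB₁ T, hB₂ T])
    · rw [Finset.sum_const, hcardT, nsmul_eq_mul]
  exact (measureReal_mono hcover).trans ((measureReal_union_le _ _).trans
    (add_le_add hsecond hunion))

/-! ### Evaluating both bounds in the critical window. -/

theorem exp_log_combination {x w : ℝ} (hx : 0 < x) (hL : 0 < Real.log x) :
    Real.exp (-(2 * (Real.log x + 1 / 2 * Real.log (Real.log x) + w))) =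
      Real.exp (-(2 * w)) / (x ^ 2 * Real.log x) := by
  have : -(2 * (Real.log x + 1 / 2 * Real.log (Real.log x) + w)) =
      -(2 * w) - (Real.log x + Real.log x + Real.log (Real.log x)) := by ring
  rw [this, Real.exp_sub, Real.exp_add, Real.exp_add, Real.exp_log hx, Real.exp_log hL]
  ring

theorem birthLaw_containsM_le_exp {n : ℕ} (hn : 6 ≤ n) {w p : ℝ} (hL : 1 ≤ Real.log n)
    (hw0 : 0 ≤ w) (hw : w ≤ 1 / 2 * Real.log (Real.log n))
    (hp : n * p = Real.log n + 1 / 2 * Real.log (Real.log n) + w) (hp1 : p ≤ 1) :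
    (birthLaw n).real {β | ∃ r, p ≤ r ∧ ContainsM (complexAt β r)} ≤
      4 * Real.exp 6 * Real.exp (-(2 * w)) := by
  set L := Real.log n
  have hn0 : (0 : ℝ) < n := by exact_mod_cast (by omega : 0 < n)
  have hl : Real.log L ≤ L - 1 := Real.log_le_sub_one_of_pos (by linarith)
  have hl0 : 0 ≤ Real.log L := Real.log_nonneg hL
  have hp0 : 0 ≤ p := by
    have : 0 ≤ n * p := by rw [hp]; linarith
    exact nonneg_of_mul_nonneg_right this hn0
  refine (birthLaw_containsM_le hn hp0 hp1).trans ?_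
  -- The factor `exp 6` absorbs `6 * p ≤ 6`.
  have h1 : Real.exp (-(p * (2 * n - 6))) ≤
      Real.exp 6 * (Real.exp (-(2 * w)) / (n ^ 2 * L)) := by
    rw [← exp_log_combination hn0 (by linarith : 0 < Real.log n), ← Real.exp_add]
    refine Real.exp_le_exp.2 ?_
    rw [← hp]
    linarith
  have h2 : (n : ℝ) ^ 3 * ((p + 2 / n)) ≤ n ^ 2 * (4 * L) := by
    have : (n : ℝ) ^ 3 * ((p + 2 / n)) = n ^ 2 * (n * p + 2) := by
      field_simp
    rw [this]
    refine mul_le_mul_of_nonneg_left ?_ (by positivity)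
    linarith
  calc _ = (n : ℝ) ^ 3 * ((p + 2 / n)) * Real.exp (-(p * (2 * n - 6))) := by ring
    _ ≤ n ^ 2 * (4 * L) * (Real.exp 6 * (Real.exp (-(2 * w)) / (n ^ 2 * L))) :=
      mul_le_mul h2 h1 (by positivity) (by positivity)
    _ = _ := by
      have : L ≠ 0 := by linarith
      field_simp

theorem cube_le_choose_three {n : ℕ} (hn : 4 ≤ n) : (n : ℝ) ^ 3 / 48 ≤ n.choose 3 := by
  have h1 := Nat.pow_le_choose (α := ℝ) 3 n
  have h2 : ((n - 2 : ℕ) : ℝ) = n - 2 := by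
    rw [Nat.cast_sub (by omega)]
    push_cast
    ring
  have h3 : (4 : ℝ) ≤ n := by exact_mod_cast hn
  have h4 : ((n : ℝ) / 2) ^ 3 ≤ (n - 2) ^ 3 := pow_le_pow_left₀ (by positivity) (by linarith) 3
  have h5 : ((Nat.factorial 3 : ℕ) : ℝ) = 6 := by norm_num [Nat.factorial]
  rw [show n + 1 - 3 = n - 2 by omega, h2, h5] at h1
  rw [div_pow] at h4
  linarith

theorem choose_three_le_cube (n : ℕ) : (n.choose 3 : ℝ) ≤ n ^ 3 := by
  exact_mod_cast Nat.choose_le_pow n 3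

theorem exp_neg_le_one_sub_pow {p : ℝ} (n : ℕ) (hp : p ≤ 1 / 2)
    (hnp : n * p ^ 2 ≤ 1) : Real.exp (-(2 * (n * p)) - 4) ≤ (1 - p) ^ (2 * n) := by
  have h1 : Real.exp (-(p + 2 * p ^ 2)) ≤ 1 - p := by
    have h2 := Real.add_one_le_exp (p + 2 * p ^ 2)
    -- It suffices that `(1 - p) * (1 + p + 2 * p ^ 2) = 1 + p ^ 2 - 2 * p ^ 3` is at least `1`,
    -- which is where `p ≤ 1 / 2` enters.
    rw [Real.exp_neg, inv_le_comm₀ (Real.exp_pos _) (by linarith)]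
    refine le_trans ?_ h2
    rw [inv_le_iff_one_le_mul₀ (by linarith)]
    nlinarith [sq_nonneg p]
  have h3 : Real.exp (-(p + 2 * p ^ 2)) ^ (2 * n) ≤ (1 - p) ^ (2 * n) :=
    pow_le_pow_left₀ (Real.exp_pos _).le h1 _
  refine le_trans ?_ h3
  rw [← Real.exp_nat_mul]
  refine Real.exp_le_exp.2 ?_
  push_cast
  linarith

theorem birthLaw_not_containsM_le_exp {n : ℕ} (hn : 4 ≤ n) {w p : ℝ} (hL : 1 ≤ Real.log n)
    (hw0 : 0 ≤ w) (hw : w ≤ 1 / 2 * Real.log (Real.log n))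
    (hp : n * p = Real.log n + 1 / 2 * Real.log (Real.log n) - w) (hp1 : p ≤ 1 / 2)
    (hnp : n * p ^ 2 ≤ 1) :
    (birthLaw n).real {β | ¬ ContainsM (complexAt β p)} ≤
      48 * Real.exp 4 * Real.exp (-(2 * w)) + (((1 - p) ^ 4)⁻¹ - 1) +
        4 * Real.exp 5 * (Real.log n / n) := by
  set L := Real.log n with hLdef
  have hn0 : (0 : ℝ) < n := by exact_mod_cast (by omega : 0 < n)
  have hl : Real.log L ≤ L - 1 := Real.log_le_sub_one_of_pos (by linarith)
  have hl0 : 0 ≤ Real.log L := Real.log_nonneg hL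
  have hLp : L ≤ n * p := by rw [hp]; linarith
  have hpL : n * p ≤ 2 * L := by rw [hp]; linarith
  have hp0 : 0 < p := pos_of_mul_pos_right (by linarith : 0 < n * p) hn0.le
  have hq1 : 0 < 1 - p := by linarith
  refine (birthLaw_not_containsM_le hn hp0 (by linarith)).trans ?_
  have hfirst : 1 / (n.choose 3 * (p * (1 - p) ^ (2 * (n - 3)))) ≤
      48 * Real.exp 4 * Real.exp (-(2 * w)) := by
    have h1 : Real.exp (2 * w) / (n ^ 2 * L) * Real.exp (-4) ≤ (1 - p) ^ (2 * (n - 3)) := by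
      have h2 := exp_log_combination (w := -w) hn0 (by linarith : 0 < Real.log n)
      rw [← sub_eq_add_neg, ← hLdef, ← hp] at h2
      have h3 : Real.exp (2 * w) / (n ^ 2 * L) * Real.exp (-4) =
          Real.exp (-(2 * (n * p)) - 4) := by
        rw [sub_eq_add_neg, Real.exp_add, h2]
        ring_nf
      rw [h3]
      refine (exp_neg_le_one_sub_pow n hp1 hnp).trans ?_
      exact pow_le_pow_of_le_one hq1.le (by linarith) (by omega)
    have h4 : (n : ℝ) ^ 3 / 48 * (L / n) ≤ n.choose 3 * p :=
      mul_le_mul (cube_le_choose_three hn) ((div_le_iff₀ hn0).2 (by linarith)) (by positivity)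
        (by positivity)
    have h5 : Real.exp (2 * w) * Real.exp (-4) / 48 ≤
        n.choose 3 * (p * (1 - p) ^ (2 * (n - 3))) := by
      calc _ = (n : ℝ) ^ 3 / 48 * (L / n) * (Real.exp (2 * w) / (n ^ 2 * L) * Real.exp (-4)) := by
            have : L ≠ 0 := by linarith
            field_simp
        _ ≤ (n.choose 3 * p) * (1 - p) ^ (2 * (n - 3)) :=
            mul_le_mul h4 h1 (by positivity) (by positivity)
        _ = _ := by ring
    refine (one_div_le_one_div_of_le (by positivity) h5).trans (le_of_eq ?_)
    rw [Real.exp_neg, Real.exp_neg]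
    field_simp
  have hlast : (n.choose 3 : ℝ) * (2 * (p * (1 - p) ^ (2 * (n - 3)) * (1 - p) ^ (n - 4))) ≤
      4 * Real.exp 5 * (L / n) := by
    -- The exponent is `3 * n - 10`; `n * p ≥ log n` gives `n ^ (-3)`, and `10 * p ≤ 5` gives `exp
    -- 5`.
    have h1 : (1 - p) ^ (2 * (n - 3)) * (1 - p) ^ (n - 4) ≤ Real.exp 5 * (1 / (n : ℝ) ^ 3) := by
      rw [← pow_add]
      refine (pow_le_pow_left₀ hq1.le (Real.one_sub_le_exp_neg p) _).trans ?_
      have h2 : (1 : ℝ) / n ^ 3 = Real.exp (-(3 * L)) := by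
        rw [Real.exp_neg, one_div]
        congr 1
        have : (3 : ℝ) * L = (3 : ℕ) * L := by norm_num
        rw [this, Real.exp_nat_mul, hLdef, Real.exp_log hn0]
      rw [h2, ← Real.exp_add, ← Real.exp_nat_mul]
      refine Real.exp_le_exp.2 ?_
      have h3 : ((2 * (n - 3) + (n - 4) : ℕ) : ℝ) = 3 * n - 10 := by
        push_cast [Nat.cast_sub (by omega : 3 ≤ n), Nat.cast_sub hn]
        ring
      rw [h3]
      linarith
    have h2 : (n.choose 3 : ℝ) * p ≤ n ^ 3 * (2 * L / n) :=
      mul_le_mul (choose_three_le_cube n) ((le_div_iff₀ hn0).2 (by linarith)) hp0.le (by positivity)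
    calc _ = 2 * (((n.choose 3 : ℝ) * p) * ((1 - p) ^ (2 * (n - 3)) * (1 - p) ^ (n - 4))) := by ring
      _ ≤ 2 * ((n ^ 3 * (2 * L / n)) * (Real.exp 5 * (1 / (n : ℝ) ^ 3))) :=
        mul_le_mul_of_nonneg_left (mul_le_mul h2 h1 (by positivity) (by positivity)) (by norm_num)
      _ = _ := by field_simp; norm_num
  linarith

/-! ### Combining the two bounds. -/

/-- Up to the two failure events, the last copy of `M` is destroyed between the times `p` and `q`. -/
theorem one_sub_le_birthLaw_destroysLastM {n : ℕ} (p q : ℝ) :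
    1 - ((birthLaw n).real {β | ¬ ContainsM (complexAt β p)} +
      (birthLaw n).real {β | ∃ r, q ≤ r ∧ ContainsM (complexAt β r)}) ≤
      (birthLaw n).real {β | ∃ T : Triple n, DestroysLastM β T ∧ p ≤ β T ∧ β T ≤ q} := by
  -- A cover with subadditivity is used rather than complements, so no event needs to be measurable.
  have hcover : (Set.univ : Set (Triple n → ℝ)) ⊆
      ({β | ¬ ContainsM (complexAt β p)} ∪ {β | ∃ r, q ≤ r ∧ ContainsM (complexAt β r)}) ∪
        {β | ∃ T : Triple n, DestroysLastM β T ∧ p ≤ β T ∧ β T ≤ q} := by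
    intro β _
    by_cases h1 : ContainsM (complexAt β p)
    · by_cases h2 : ∃ r, q ≤ r ∧ ContainsM (complexAt β r)
      · exact Or.inl (Or.inr h2)
      · push Not at h2
        exact Or.inr (exists_destroysLastM h1 h2)
    · exact Or.inl (Or.inl h1)
  have h1 : (birthLaw n).real Set.univ ≤ _ := measureReal_mono hcover
  rw [probReal_univ] at h1
  have h2 := measureReal_union_le (μ := birthLaw n)
    ({β | ¬ ContainsM (complexAt β p)} ∪ {β | ∃ r, q ≤ r ∧ ContainsM (complexAt β r)})
    {β | ∃ T : Triple n, DestroysLastM β T ∧ p ≤ β T ∧ β T ≤ q}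
  have h3 := measureReal_union_le (μ := birthLaw n)
    {β | ¬ ContainsM (complexAt β p)} {β | ∃ r, q ≤ r ∧ ContainsM (complexAt β r)}
  linarith

end HypergraphComplex

open HypergraphComplex in
theorem mainTheorem3 (ω : ℕ → ℝ) (hω : Tendsto ω atTop atTop) :
    Tendsto
      (fun n : ℕ => HypergraphComplex.birthLaw n
        {β | ∃ T : HypergraphComplex.Triple n, HypergraphComplex.DestroysLastM β T ∧
          |(n : ℝ) * β T - (Real.log n + 1 / 2 * Real.log (Real.log n))| ≤ ω n})
      atTop (𝓝 1) := by
  have hL : Tendsto (fun n : ℕ => Real.log n) atTop atTop :=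
    Real.tendsto_log_atTop.comp tendsto_natCast_atTop_atTop
  have hl : Tendsto (fun n : ℕ => 1 / 2 * Real.log (Real.log n)) atTop atTop :=
    (Real.tendsto_log_atTop.comp hL).const_mul_atTop (by norm_num)
  -- The cap keeps `n * p n` and `n * q n` between `log n` and `2 * log n` for large `n`; shrinking
  -- the window only strengthens the claim.
  set w : ℕ → ℝ := fun n => min (ω n) (1 / 2 * Real.log (Real.log n))
  have hw : Tendsto w atTop atTop := tendsto_atTop.2 fun r => by
    filter_upwards [hω.eventually_ge_atTop r, hl.eventually_ge_atTop r] with n h1 h2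
    exact le_min h1 h2
  have hlog : ∀ k : ℕ, Tendsto (fun n : ℕ => Real.log n ^ k / n) atTop (𝓝 0) := fun k => by
    have := (Real.tendsto_pow_log_div_mul_add_atTop 1 0 k one_ne_zero).comp
      (tendsto_natCast_atTop_atTop (R := ℝ))
    simpa [Function.comp_def] using this
  set p : ℕ → ℝ := fun n => (Real.log n + 1 / 2 * Real.log (Real.log n) - w n) / n
  set q : ℕ → ℝ := fun n => (Real.log n + 1 / 2 * Real.log (Real.log n) + w n) / n
  have hreg : ∀ᶠ n : ℕ in atTop, 6 ≤ n ∧ 1 ≤ Real.log n ∧ 0 ≤ w n ∧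
      Real.log n ^ 1 / n ≤ 1 / 4 ∧ Real.log n ^ 2 / n ≤ 1 / 4 :=
    (eventually_ge_atTop 6).and ((hL.eventually_ge_atTop 1).and ((hw.eventually_ge_atTop 0).and
      (((hlog 1).eventually_le_const (by norm_num)).and
        ((hlog 2).eventually_le_const (by norm_num)))))
  have hpq : ∀ᶠ n : ℕ in atTop, 0 ≤ p n ∧ p n ≤ 2 * (Real.log n ^ 1 / n) ∧
      q n ≤ 2 * (Real.log n ^ 1 / n) := by
    filter_upwards [hreg] with n ⟨hn, hLn, hw0, _, _⟩
    have hn0 : (0 : ℝ) < n := by exact_mod_cast (by omega : 0 < n)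
    have hll : Real.log (Real.log n) ≤ Real.log n - 1 :=
      Real.log_le_sub_one_of_pos (by linarith)
    have hwl : w n ≤ 1 / 2 * Real.log (Real.log n) := min_le_right _ _
    refine ⟨div_nonneg (by linarith) hn0.le, ?_, ?_⟩
    · rw [← mul_div_assoc, pow_one]
      exact div_le_div_of_nonneg_right (by linarith) hn0.le
    · rw [← mul_div_assoc, pow_one]
      exact div_le_div_of_nonneg_right (by linarith) hn0.le
  have hp0 : Tendsto p atTop (𝓝 0) := by
    have h2 : Tendsto (fun n : ℕ => 2 * (Real.log n ^ 1 / n)) atTop (𝓝 0) := by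
      simpa using (hlog 1).const_mul 2
    exact squeeze_zero' (hpq.mono fun n h => h.1) (hpq.mono fun n h => h.2.1) h2
  set err : ℕ → ℝ := fun n =>
    (48 * Real.exp 4 * Real.exp (-(2 * w n)) + (((1 - p n) ^ 4)⁻¹ - 1) +
      4 * Real.exp 5 * (Real.log n ^ 1 / n)) + 4 * Real.exp 6 * Real.exp (-(2 * w n))
  have herr : Tendsto err atTop (𝓝 0) := by
    have h1 : Tendsto (fun n => Real.exp (-(2 * w n))) atTop (𝓝 0) :=
      Real.tendsto_exp_neg_atTop_nhds_zero.comp (hw.const_mul_atTop (by norm_num))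
    have h2 : Tendsto (fun n => ((1 - p n) ^ 4)⁻¹) atTop (𝓝 ((1 - 0) ^ 4)⁻¹) :=
      ((hp0.const_sub 1).pow 4).inv₀ (by norm_num)
    have h3 := (((h1.const_mul (48 * Real.exp 4)).add (h2.sub_const 1)).add
      ((hlog 1).const_mul (4 * Real.exp 5))).add (h1.const_mul (4 * Real.exp 6))
    simpa [err] using h3
  have hlower : Tendsto (fun n => ENNReal.ofReal (1 - err n)) atTop (𝓝 1) := by
    have h1 := ENNReal.tendsto_ofReal (herr.const_sub 1)
    simpa using h1
  refine tendsto_of_tendsto_of_tendsto_of_le_of_le' hlower tendsto_const_nhds ?_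
    (Eventually.of_forall fun n => prob_le_one)
  filter_upwards [hreg, hpq] with n ⟨hn, hLn, hw0, hlog1, hlog2⟩ ⟨hpn0, hpn, hqn⟩
  have hn0 : (0 : ℝ) < n := by exact_mod_cast (by omega : 0 < n)
  have hnp : n * p n = Real.log n + 1 / 2 * Real.log (Real.log n) - w n :=
    mul_div_cancel₀ _ hn0.ne'
  have hnq : n * q n = Real.log n + 1 / 2 * Real.log (Real.log n) + w n :=
    mul_div_cancel₀ _ hn0.ne'
  have hwl : w n ≤ 1 / 2 * Real.log (Real.log n) := min_le_right _ _
  have hsq : n * p n ^ 2 ≤ 1 := by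
    have h1 : p n ^ 2 ≤ (2 * (Real.log n ^ 1 / n)) ^ 2 := pow_le_pow_left₀ hpn0 hpn 2
    calc n * p n ^ 2 ≤ n * (2 * (Real.log n ^ 1 / n)) ^ 2 := by gcongr
      _ = 4 * (Real.log n ^ 2 / n) := by field_simp; ring
      _ ≤ 1 := by linarith
  have h1 := birthLaw_not_containsM_le_exp (by omega) hLn hw0 hwl hnp (by linarith) hsq
  have h2 := birthLaw_containsM_le_exp hn hLn hw0 hwl hnq (by linarith)
  have h3 := one_sub_le_birthLaw_destroysLastM (n := n) (p n) (q n)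
  have h4 : 1 - err n ≤
      (birthLaw n).real {β | ∃ T : Triple n, DestroysLastM β T ∧ p n ≤ β T ∧ β T ≤ q n} := by
    simp only [err, pow_one]
    linarith
  refine (ENNReal.ofReal_le_iff_le_toReal (measure_ne_top _ _)).2
    (h4.trans (measureReal_mono ?_))
  rintro β ⟨T, hT, hpT, hTq⟩
  have habs : |(n : ℝ) * β T - (Real.log n + 1 / 2 * Real.log (Real.log n))| ≤ w n := by
    have hpT' := mul_le_mul_of_nonneg_left hpT hn0.le
    have hTq' := mul_le_mul_of_nonneg_left hTq hn0.le
    exact abs_le.2 ⟨by linarith, by linarith⟩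
  exact ⟨T, hT, habs.trans (min_le_left _ _)⟩
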